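/- Conventions. A crossed module (of groupoids) $\mathcal A=(A_2,A_1,\delta)$ over an object set $A_0$ consists of a groupoid $A_1$ over $A_0$ with source $\alpha$ and target $\beta$, written additively ($a+b$ is defined when $\beta a=\alpha b$, and $O_x$ is the zero at $x$), groups $A_2(x)$, $x\in A_0$, homomorphisms $\delta:A_2(x)\to A_1(x,x)$, and a right action $(c,a)\mapsto c^a$, $A_2(x)\times A_1(x,y)\to A_2(y)$, of $A_1$ on $A_2$, with $\delta(c^a)=-a+\delta c+a$ and $c^{\delta c'}=-c'+c+c'$. Morphisms are triples $f=(f_0,f_1,f_2)$ compatible with all of this. The internal hom $\mathsf{CMOD}(\mathcal B,\mathcal D)$ is the following crossed module. Its objects are the morphisms $\mathcal B\to\mathcal D$. Its arrows $f\to g$ are the homotopies $f\simeq g$, i.e. the pairs $(s_0,s_1)$ with $s_0(x)\in D_1(f_0x,g_0x)$ for $x\in B_0$ and $s_1(a)\in D_2(g_0\beta a)$ for $a\in B_1$, satisfying $s_1(a+b)=s_1(a)^{g_1b}+s_1(b)$, $f_1(a)=s_0(\alpha a)+g_1a+\delta s_1(a)-s_0(\beta a)$ and $f_2(c)=(g_2c+s_1\delta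 c)^{-s_0(x)}$ for $c\in B_2(x)$; they are added by $(s+t)_0(x)=s_0(x)+t_0(x)$ and $(s+t)_1(a)=t_1(a)+s_1(a)^{t_0(\beta a)}$. Its group at $f$ is the group of families $s_2(x)\in D_2(f_0x)$, $x\in B_0$, under pointwise addition, with $\delta(s_2)=\bigl(x\mapsto\delta s_2(x),\ a\mapsto -s_2(\alpha a)^{f_1a}+s_2(\beta a)\bigr)$ and $(s_2)^{(t_0,t_1)}(x)=s_2(x)^{t_0(x)}$. Write $\mathsf{END}(\mathcal C)=\mathsf{CMOD}(\mathcal C,\mathcal C)$. A bimorphism $b:\mathcal A,\mathcal B\to\mathcal D$ is a family of maps $b_{ij}:A_i\times B_j\to D_{i+j}$, $i+j\le 2$ (written $x.y$, $x.b$, $a.y$, $x.c'$, $c.y$ if $ij=0$, and $\{a,b\}$ if $i=j=1$), such that for every $x\in A_0$ and every $y\in B_0$ the maps $x.(-)$ and $(-).y$ are morphisms of crossed modules $\mathcal B\to\mathcal D$ and $\mathcal A\to\mathcal D$, and such that, whenever the sums are defined, $$\{a,b\}\in D_2(\beta a.\beta b),\qquad \{a,b+b'\}=\{a,b\}^{\beta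 a.b'}+\{a,b'\},\qquad \{a+a',b\}=\{a',b\}+\{a,b\}^{a'.\beta b},$$ $$\delta\{a,b\}=-(\beta a.b)-a.\alpha b+\alpha a.b+a.\beta b,$$ $$\{a,\delta c'\}=-(\beta a.c')+(\alpha a.c')^{a.y}\ \ (c'\in B_2(y)),\qquad \{\delta c,b\}=-(c.\alpha b)^{x.b}+c.\beta b\ \ (c\in A_2(x)).$$ The tensor product $\mathcal A\otimes\mathcal B$ is the target of the universal bimorphism out of $\mathcal A,\mathcal B$, so that morphisms $\mathcal A\otimes\mathcal B\to\mathcal D$ correspond bijectively to bimorphisms $\mathcal A,\mathcal B\to\mathcal D$, and hence, through a bijection $\theta$, to morphisms $\mathcal A\to\mathsf{CMOD}(\mathcal B,\mathcal D)$. Let $*$ be the terminal crossed module, let $\varepsilon:\mathsf{END}(\mathcal C)\otimes\mathcal C\to\mathcal C$ be the morphism with $\theta(\varepsilon)=\mathrm{id}$, let $\mu:\mathsf{END}(\mathcal C)\otimes\mathsf{END}(\mathcal C)\to\mathsf{END}(\mathcal C)$ be the morphism corresponding under $\theta$ to $$(\mathsf{END}(\mathcal C)\otimes\mathsf{END}(\mathcal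 C))\otimes\mathcal C\to\mathsf{END}(\mathcal C)\otimes(\mathsf{END}(\mathcal C)\otimes\mathcal C)\xrightarrow{1\otimes\varepsilon}\mathsf{END}(\mathcal C)\otimes\mathcal C\xrightarrow{\varepsilon}\mathcal C,$$ where the first arrow is the associativity morphism, and let $\eta:*\to\mathsf{END}(\mathcal C)$ correspond under $\theta$ to the canonical morphism $*\otimes\mathcal C\to\mathcal C$. The structure of a braided semiregular crossed module on $\mathcal A$ is a bimorphism $b:\mathcal A,\mathcal A\to\mathcal A$ together with an element $e\in A_0$ such that $b_{00}$ is a monoid structure on $A_0$ with identity $e$; for $i=1,2$ the maps $b_{0i}$ and $b_{i0}$ are a left and a right action of this monoid on $A_i$ which commute, $x.(c.y)=(x.c).y$; $\{O_e,b\}=O_{\beta b}$ and $\{a,O_e\}=O_{\beta a}$; and $x.\{a,b\}=\{x.a,b\}$, $\{a,b\}.x=\{a,b.x\}$, $\{a.x,b\}=\{a,x.b\}$ for all $x\in A_0$ and $a,b\in A_1$. The map $\{\,,\}$ is called the braiding. Statement. Let $\mathcal C$ be a crossed module of groupoids. Then $(\mathsf{END}(\mathcal C),\mu,\eta)$ is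 a monoid with respect to $\otimes$ (the associativity law and both unit laws hold), and the bimorphism $\mathsf{END}(\mathcal C),\mathsf{END}(\mathcal C)\to\mathsf{END}(\mathcal C)$ corresponding to $\mu$, together with the object $e$ of $\mathsf{END}(\mathcal C)$ picked out by $\eta$, is the structure of a braided semiregular crossed module on $\mathsf{END}(\mathcal C)$. -/

import Mathlib

open CategoryTheory

universe u

noncomputable section

/-- A crossed module of groupoids `δ : C → G` over an object set `Obj`.  The groupoid `G` is a
Mathlib groupoid (composition `a ≫ b` is `a + b` in additive notation), the totally intransitive
groupoid `C` is the family of groups `Two x` (the vertex groups `C(x)`, written multiplicatively),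
and `act c a` is `c ^ a`. -/
structure CrossedModule : Type (u + 1) where
  Obj : Type u
  [grpd : Groupoid.{u} Obj]
  Two : Obj → Type u
  [grp : ∀ x, Group (Two x)]
  δ : ∀ {x : Obj}, Two x → (x ⟶ x)
  δ_mul : ∀ {x : Obj} (c d : Two x), δ (c * d) = δ c ≫ δ d
  act : ∀ {x y : Obj}, Two x → (x ⟶ y) → Two y
  mul_act : ∀ {x y : Obj} (c d : Two x) (a : x ⟶ y), act (c * d) a = act c a * act d a
  act_comp : ∀ {x y z : Obj} (c : Two x) (a : x ⟶ y) (b : y ⟶ z),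
    act c (a ≫ b) = act (act c a) b
  act_id : ∀ {x : Obj} (c : Two x), act c (𝟙 x) = c
  δ_act : ∀ {x y : Obj} (c : Two x) (a : x ⟶ y), δ (act c a) = inv a ≫ δ c ≫ a
  act_δ : ∀ {x : Obj} (c d : Two x), act c (δ d) = d⁻¹ * c * d

attribute [instance] CrossedModule.grpd CrossedModule.grp

namespace CrossedModule

theorem eq_of_groupoid_inv {X : Type*} [Groupoid X] {v w y z : X} {p : y ⟶ v} {q : z ⟶ y}
    {r : z ⟶ w} {k : w ⟶ v} {l : v ⟶ v}
    (h : l = Groupoid.inv p ≫ Groupoid.inv q ≫ r ≫ k) : l = inv p ≫ inv q ≫ r ≫ k := by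
  simpa using h

theorem conj_of_groupoid_inv {X : Type*} [Groupoid X] {v w : X} {p : v ⟶ w} {r : v ⟶ v}
    {l : w ⟶ w} (h : l = Groupoid.inv p ≫ r ≫ p) : l = inv p ≫ r ≫ p := by
  simpa using h

section Basic

variable (A : CrossedModule.{u})

theorem δ_one (x : A.Obj) : A.δ (1 : A.Two x) = 𝟙 x := by
  have h := A.δ_mul (1 : A.Two x) 1
  rw [mul_one] at h
  rw [← cancel_epi (A.δ (1 : A.Two x)), ← h, Category.comp_id]

theorem δ_inv {x : A.Obj} (c : A.Two x) : A.δ c⁻¹ = inv (A.δ c) := by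
  rw [← cancel_epi (A.δ c), ← A.δ_mul, mul_inv_cancel, δ_one, IsIso.hom_inv_id]

theorem one_act {x y : A.Obj} (a : x ⟶ y) : A.act (1 : A.Two x) a = 1 := by
  have h := A.mul_act (1 : A.Two x) 1 a
  rw [mul_one] at h
  exact (mul_eq_left (a := A.act (1 : A.Two x) a)).1 h.symm

theorem inv_act {x y : A.Obj} (c : A.Two x) (a : x ⟶ y) : A.act c⁻¹ a = (A.act c a)⁻¹ := by
  rw [eq_inv_iff_mul_eq_one, ← A.mul_act, inv_mul_cancel, one_act]

theorem act_act_inv {x y : A.Obj} (c : A.Two x) (a : x ⟶ y) :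
    A.act (A.act c a) (inv a) = c := by
  rw [← A.act_comp, IsIso.hom_inv_id, A.act_id]

theorem act_inv_act {x y : A.Obj} (c : A.Two y) (a : x ⟶ y) :
    A.act (A.act c (inv a)) a = c := by
  rw [← A.act_comp, IsIso.inv_hom_id, A.act_id]

end Basic

/-- Morphisms of crossed modules: a functor `(f₀, f₁)` between the groupoids together with
homomorphisms `f₂` of the vertex groups, compatible with boundaries and actions. -/
@[ext]
structure Hom (A B : CrossedModule.{u}) : Type u where
  fn : A.Obj ⥤ B.Obj
  two : ∀ {x : A.Obj}, A.Two x → B.Two (fn.obj x)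
  two_mul : ∀ {x : A.Obj} (c d : A.Two x), two (c * d) = two c * two d
  map_δ : ∀ {x : A.Obj} (c : A.Two x), fn.map (A.δ c) = B.δ (two c)
  two_act : ∀ {x y : A.Obj} (c : A.Two x) (a : x ⟶ y),
    two (A.act c a) = B.act (two c) (fn.map a)

theorem Hom.two_one {A B : CrossedModule.{u}} (f : Hom A B) (x : A.Obj) :
    f.two (1 : A.Two x) = 1 := by
  have h := f.two_mul (1 : A.Two x) 1
  rw [mul_one] at h
  exact (mul_eq_left (a := f.two (1 : A.Two x))).1 h.symm

theorem Hom.two_inv {A B : CrossedModule.{u}} (f : Hom A B) {x : A.Obj} (c : A.Two x) :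
    f.two c⁻¹ = (f.two c)⁻¹ := by
  rw [eq_inv_iff_mul_eq_one, ← f.two_mul, inv_mul_cancel, f.two_one]

/-- The identity morphism. -/
def Hom.id (A : CrossedModule.{u}) : Hom A A where
  fn := 𝟭 A.Obj
  two c := c
  two_mul _ _ := rfl
  map_δ _ := rfl
  two_act _ _ := rfl

/-- The composite "first `f`, then `g`". -/
def Hom.comp {A B D : CrossedModule.{u}} (f : Hom A B) (g : Hom B D) : Hom A D where
  fn := f.fn ⋙ g.fn
  two c := g.two (f.two c)
  two_mul c d := by rw [f.two_mul, g.two_mul]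
  map_δ c := by simp only [Functor.comp_map, f.map_δ, g.map_δ]
  two_act c a := by simp only [Functor.comp_map, f.two_act, g.two_act]

/-- The terminal crossed module: one object, all groups trivial. -/
def point : CrossedModule.{u} where
  Obj := Discrete PUnit.{u + 1}
  Two _ := PUnit.{u + 1}
  δ _ := 𝟙 _
  δ_mul _ _ := (Category.comp_id _).symm
  act _ _ := 1
  mul_act _ _ _ := rfl
  act_comp _ _ _ := rfl
  act_id _ := rfl
  δ_act _ _ := Subsingleton.elim _ _
  act_δ _ _ := rfl

/-! ### Homotopies and the internal hom -/

/-- A homotopy `f ≃ g` of morphisms `B → D`: a pair `(s₀, s₁)` over `g`, where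
`s₀ x : f₀ x ⟶ g₀ x`, where `s₁` is a `g`-derivation, and where `f` is the morphism determined by
`g` and `(s₀, s₁)`. -/
@[ext]
structure Homotopy {B D : CrossedModule.{u}} (f g : Hom B D) : Type u where
  s₀ : ∀ x : B.Obj, f.fn.obj x ⟶ g.fn.obj x
  s₁ : ∀ {x y : B.Obj}, (x ⟶ y) → D.Two (g.fn.obj y)
  deriv : ∀ {x y z : B.Obj} (a : x ⟶ y) (b : y ⟶ z),
    s₁ (a ≫ b) = D.act (s₁ a) (g.fn.map b) * s₁ b
  source_map : ∀ {x y : B.Obj} (a : x ⟶ y),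
    f.fn.map a = s₀ x ≫ g.fn.map a ≫ D.δ (s₁ a) ≫ inv (s₀ y)
  source_two : ∀ {x : B.Obj} (c : B.Two x),
    f.two c = D.act (g.two c * s₁ (B.δ c)) (inv (s₀ x))

namespace Homotopy

variable {B D : CrossedModule.{u}} {f g h : Hom B D}

theorem s₁_id (s : Homotopy f g) (x : B.Obj) : s.s₁ (𝟙 x) = 1 := by
  have h := s.deriv (𝟙 x) (𝟙 x)
  rw [Category.comp_id, CategoryTheory.Functor.map_id, D.act_id] at h
  exact (mul_eq_left (a := s.s₁ (𝟙 x))).1 h.symm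

/-- The identity homotopy of `f`. -/
def refl (f : Hom B D) : Homotopy f f where
  s₀ x := 𝟙 _
  s₁ a := 1
  deriv a b := by rw [D.one_act, mul_one]
  source_map a := by simp [D.δ_one]
  source_two c := by simp [D.act_id]

/-- The sum `s + t` of homotopies: `(s + t)₀ = s₀ + t₀` and
`(s + t)₁ a = t₁ a + (s₁ a) ^ (t₀ (β a))`. -/
def trans (s : Homotopy f g) (t : Homotopy g h) : Homotopy f h where
  s₀ x := s.s₀ x ≫ t.s₀ x
  s₁ {_ y} a := t.s₁ a * D.act (s.s₁ a) (t.s₀ y)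
  deriv {x y z} a b := by
    have e : D.act (D.act (s.s₁ a) (g.fn.map b)) (t.s₀ z)
        = (t.s₁ b)⁻¹ * D.act (D.act (s.s₁ a) (t.s₀ y)) (h.fn.map b) * t.s₁ b := by
      rw [← D.act_δ, ← D.act_comp, ← D.act_comp, ← D.act_comp, t.source_map b]
      simp
    rw [t.deriv, s.deriv, D.mul_act, D.mul_act, e]
    group
  source_map {x y} a := by
    rw [s.source_map a, t.source_map a, D.δ_mul, D.δ_act]
    simp
  source_two {x} c := by
    rw [s.source_two c, t.source_two c, D.mul_act, IsIso.inv_comp, D.act_comp, ← mul_assoc,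
      D.mul_act _ (D.act (s.s₁ _) _), D.act_act_inv, ← D.mul_act]

/-- The negative of a homotopy. -/
def symm (s : Homotopy f g) : Homotopy g f where
  s₀ x := inv (s.s₀ x)
  s₁ {_ y} a := D.act (s.s₁ a)⁻¹ (inv (s.s₀ y))
  deriv {x y z} a b := by
    have e : D.act (D.act (s.s₁ a)⁻¹ (inv (s.s₀ y))) (f.fn.map b)
        = D.act (D.act (D.act (s.s₁ a)⁻¹ (g.fn.map b)) (D.δ (s.s₁ b))) (inv (s.s₀ z)) := by
      rw [← D.act_comp, ← D.act_comp, ← D.act_comp, s.source_map b]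
      simp
    rw [e, s.deriv, ← D.mul_act, D.act_δ, mul_inv_rev, D.inv_act]
    congr 1
    group
  source_map {x y} a := by
    rw [s.source_map a, D.δ_act, D.δ_inv]
    simp
  source_two {x} c := by
    rw [s.source_two c, ← D.mul_act, mul_inv_cancel_right, IsIso.inv_inv, D.act_inv_act]

end Homotopy

/-- The groupoid of morphisms `B → D` and homotopies between them. -/
instance homGroupoid (B D : CrossedModule.{u}) : Groupoid.{u} (Hom B D) where
  Hom f g := Homotopy f g
  id f := Homotopy.refl f
  comp s t := s.trans t
  inv s := s.symm
  id_comp s := by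
    ext <;> simp [Homotopy.trans, Homotopy.refl, D.one_act]
  comp_id s := by
    ext <;> simp [Homotopy.trans, Homotopy.refl, D.act_id]
  assoc s t r := by
    ext <;> simp [Homotopy.trans, D.mul_act, D.act_comp, mul_assoc]
  inv_comp s := by
    ext <;> simp [Homotopy.trans, Homotopy.refl, Homotopy.symm, D.inv_act, D.act_inv_act]
  comp_inv s := by
    ext <;> simp [Homotopy.trans, Homotopy.refl, Homotopy.symm, ← D.mul_act, D.one_act]

/-- The boundary of a section `s₂` over `f`: the homotopy
`(δ s₂, a ↦ - (s₂ (α a)) ^ (f₁ a) + s₂ (β a))` from `f` to itself. -/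
def sectionBoundary {B D : CrossedModule.{u}} (f : Hom B D) (s : ∀ x : B.Obj, D.Two (f.fn.obj x)) :
    Homotopy f f where
  s₀ x := D.δ (s x)
  s₁ {x y} a := (D.act (s x) (f.fn.map a))⁻¹ * s y
  deriv a b := by
    rw [D.mul_act, D.inv_act, Functor.map_comp, D.act_comp]
    group
  source_map a := by
    rw [D.δ_mul, D.δ_inv, D.δ_act]
    simp
  source_two {x} c := by
    rw [f.map_δ, D.act_δ, ← D.δ_inv, D.act_δ]
    group

/-- The internal hom `CMOD(B, D)`: its objects are the morphisms `B → D`, its arrows `f ⟶ g` are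
the homotopies `f ≃ g`, and its vertex group at `f` is the group of sections over `f`, that is of
the families `s₂ x ∈ D.Two (f₀ x)`, under pointwise operations. -/
def CMOD (B D : CrossedModule.{u}) : CrossedModule.{u} where
  Obj := Hom B D
  Two f := ∀ x : B.Obj, D.Two (f.fn.obj x)
  δ {f} s := sectionBoundary f s
  δ_mul {f} s t := by
    apply Homotopy.ext
    · funext x
      exact D.δ_mul _ _
    · funext x y a
      change (D.act (s x * t x) (f.fn.map a))⁻¹ * (s y * t y)
        = (D.act (t x) (f.fn.map a))⁻¹ * t y
          * D.act ((D.act (s x) (f.fn.map a))⁻¹ * s y) (D.δ (t y))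
      rw [D.act_δ, D.mul_act]
      group
  act {f g} s (t : Homotopy f g) x := D.act (s x) (t.s₀ x)
  mul_act s t r := by
    funext x
    exact D.mul_act _ _ _
  act_comp s t r := by
    funext x
    exact D.act_comp _ _ _
  act_id s := by
    funext x
    exact D.act_id _
  δ_act {f g} s (t : Homotopy f g) := by
    rw [← Groupoid.inv_eq_inv]
    apply Homotopy.ext
    · funext x
      exact D.δ_act _ _
    · funext x y a
      change (D.act (D.act (s x) (t.s₀ x)) (g.fn.map a))⁻¹ * D.act (s y) (t.s₀ y)
        = (t.s₁ a * D.act ((D.act (s x) (f.fn.map a))⁻¹ * s y) (t.s₀ y))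
          * D.act (D.act (t.s₁ a)⁻¹ (inv (t.s₀ y))) (D.δ (s y) ≫ t.s₀ y)
      have e : D.act (D.act (s x) (f.fn.map a)) (t.s₀ y)
          = (t.s₁ a)⁻¹ * D.act (D.act (s x) (t.s₀ x)) (g.fn.map a) * t.s₁ a := by
        rw [← D.act_δ, ← D.act_comp, ← D.act_comp, ← D.act_comp, t.source_map a]
        simp
      rw [D.mul_act, D.inv_act, e, D.act_comp, D.act_δ, D.mul_act, D.mul_act, D.act_inv_act,
        D.inv_act]
      group
  act_δ s t := by
    funext x
    exact D.act_δ _ _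

/-- `END(C) = CMOD(C, C)`. -/
def END (C : CrossedModule.{u}) : CrossedModule.{u} := CMOD C C

/-! ### Bimorphisms -/

/-- A bimorphism `A, B → D`: maps `bᵢⱼ : Aᵢ × Bⱼ → Dᵢ₊ⱼ` for `i + j ≤ 2`, such that fixing an
object in one variable gives a morphism of crossed modules in the other one, and such that `b₁₁`
satisfies the (signed) biadditivity, boundary and degree three conditions. -/
@[ext]
structure Bimorphism (A B D : CrossedModule.{u}) : Type u where
  b₀₀ : A.Obj → B.Obj → D.Obj
  b₁₀ : ∀ {x x' : A.Obj}, (x ⟶ x') → ∀ y : B.Obj, (b₀₀ x y ⟶ b₀₀ x' y)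
  b₀₁ : ∀ (x : A.Obj) {y y' : B.Obj}, (y ⟶ y') → (b₀₀ x y ⟶ b₀₀ x y')
  b₂₀ : ∀ {x : A.Obj}, A.Two x → ∀ y : B.Obj, D.Two (b₀₀ x y)
  b₀₂ : ∀ (x : A.Obj) {y : B.Obj}, B.Two y → D.Two (b₀₀ x y)
  b₁₁ : ∀ {x x' : A.Obj} {y y' : B.Obj}, (x ⟶ x') → (y ⟶ y') → D.Two (b₀₀ x' y')
  b₁₀_comp : ∀ {x x' x'' : A.Obj} (a : x ⟶ x') (a' : x' ⟶ x'') (y : B.Obj),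
    b₁₀ (a ≫ a') y = b₁₀ a y ≫ b₁₀ a' y
  b₀₁_comp : ∀ (x : A.Obj) {y y' y'' : B.Obj} (b : y ⟶ y') (b' : y' ⟶ y''),
    b₀₁ x (b ≫ b') = b₀₁ x b ≫ b₀₁ x b'
  b₂₀_mul : ∀ {x : A.Obj} (c c' : A.Two x) (y : B.Obj), b₂₀ (c * c') y = b₂₀ c y * b₂₀ c' y
  b₀₂_mul : ∀ (x : A.Obj) {y : B.Obj} (d d' : B.Two y), b₀₂ x (d * d') = b₀₂ x d * b₀₂ x d'
  b₂₀_act : ∀ {x x' : A.Obj} (c : A.Two x) (a : x ⟶ x') (y : B.Obj),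
    b₂₀ (A.act c a) y = D.act (b₂₀ c y) (b₁₀ a y)
  b₀₂_act : ∀ (x : A.Obj) {y y' : B.Obj} (d : B.Two y) (b : y ⟶ y'),
    b₀₂ x (B.act d b) = D.act (b₀₂ x d) (b₀₁ x b)
  b₁₀_δ : ∀ {x : A.Obj} (c : A.Two x) (y : B.Obj), b₁₀ (A.δ c) y = D.δ (b₂₀ c y)
  b₀₁_δ : ∀ (x : A.Obj) {y : B.Obj} (d : B.Two y), b₀₁ x (B.δ d) = D.δ (b₀₂ x d)
  b₁₁_comp_right : ∀ {x x' : A.Obj} {y y' y'' : B.Obj} (a : x ⟶ x') (b : y ⟶ y') (b' : y' ⟶ y''),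
    b₁₁ a (b ≫ b') = D.act (b₁₁ a b) (b₀₁ x' b') * b₁₁ a b'
  b₁₁_comp_left : ∀ {x x' x'' : A.Obj} {y y' : B.Obj} (a : x ⟶ x') (a' : x' ⟶ x'') (b : y ⟶ y'),
    b₁₁ (a ≫ a') b = b₁₁ a' b * D.act (b₁₁ a b) (b₁₀ a' y')
  δ_b₁₁ : ∀ {x x' : A.Obj} {y y' : B.Obj} (a : x ⟶ x') (b : y ⟶ y'),
    D.δ (b₁₁ a b) = inv (b₀₁ x' b) ≫ inv (b₁₀ a y) ≫ b₀₁ x b ≫ b₁₀ a y'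
  b₁₁_δ_right : ∀ {x x' : A.Obj} {y : B.Obj} (a : x ⟶ x') (d : B.Two y),
    b₁₁ a (B.δ d) = (b₀₂ x' d)⁻¹ * D.act (b₀₂ x d) (b₁₀ a y)
  b₁₁_δ_left : ∀ {x : A.Obj} {y y' : B.Obj} (c : A.Two x) (b : y ⟶ y'),
    b₁₁ (A.δ c) b = (D.act (b₂₀ c y) (b₀₁ x b))⁻¹ * b₂₀ c y'

namespace Bimorphism

variable {A B D : CrossedModule.{u}} (β : Bimorphism A B D)

theorem b₁₀_id (x : A.Obj) (y : B.Obj) : β.b₁₀ (𝟙 x) y = 𝟙 _ := by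
  have h := β.b₁₀_comp (𝟙 x) (𝟙 x) y
  rw [Category.comp_id] at h
  rw [← cancel_epi (β.b₁₀ (𝟙 x) y), ← h, Category.comp_id]

theorem b₀₁_id (x : A.Obj) (y : B.Obj) : β.b₀₁ x (𝟙 y) = 𝟙 _ := by
  have h := β.b₀₁_comp x (𝟙 y) (𝟙 y)
  rw [Category.comp_id] at h
  rw [← cancel_epi (β.b₀₁ x (𝟙 y)), ← h, Category.comp_id]

theorem b₀₂_one (x : A.Obj) (y : B.Obj) : β.b₀₂ x (1 : B.Two y) = 1 := by
  have h := β.b₀₂_mul x (1 : B.Two y) 1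
  rw [mul_one] at h
  exact (mul_eq_left (a := β.b₀₂ x (1 : B.Two y))).1 h.symm

theorem b₀₂_inv (x : A.Obj) {y : B.Obj} (d : B.Two y) : β.b₀₂ x d⁻¹ = (β.b₀₂ x d)⁻¹ := by
  rw [eq_inv_iff_mul_eq_one, ← β.b₀₂_mul, inv_mul_cancel, b₀₂_one]

theorem b₁₀_inv {x x' : A.Obj} (a : x ⟶ x') (y : B.Obj) :
    β.b₁₀ (inv a) y = inv (β.b₁₀ a y) := by
  rw [← cancel_epi (β.b₁₀ a y), ← β.b₁₀_comp, IsIso.hom_inv_id, b₁₀_id, IsIso.hom_inv_id]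

theorem b₀₁_inv (x : A.Obj) {y y' : B.Obj} (b : y ⟶ y') :
    β.b₀₁ x (inv b) = inv (β.b₀₁ x b) := by
  rw [← cancel_epi (β.b₀₁ x b), ← β.b₀₁_comp, IsIso.hom_inv_id, b₀₁_id, IsIso.hom_inv_id]

theorem b₁₁_id_right {x x' : A.Obj} (a : x ⟶ x') (y : B.Obj) : β.b₁₁ a (𝟙 y) = 1 := by
  have h := β.b₁₁_comp_right a (𝟙 y) (𝟙 y)
  rw [Category.comp_id, b₀₁_id, D.act_id] at h
  exact (mul_eq_left (a := β.b₁₁ a (𝟙 y))).1 h.symm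

/-- Composing a bimorphism with a morphism out of its target. -/
def postcomp {E : CrossedModule.{u}} (f : Hom D E) : Bimorphism A B E where
  b₀₀ x y := f.fn.obj (β.b₀₀ x y)
  b₁₀ a y := f.fn.map (β.b₁₀ a y)
  b₀₁ x _ _ b := f.fn.map (β.b₀₁ x b)
  b₂₀ c y := f.two (β.b₂₀ c y)
  b₀₂ x _ d := f.two (β.b₀₂ x d)
  b₁₁ a b := f.two (β.b₁₁ a b)
  b₁₀_comp _ _ _ := by simp [β.b₁₀_comp]
  b₀₁_comp _ _ _ _ _ _ := by simp [β.b₀₁_comp]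
  b₂₀_mul _ _ _ := by simp [β.b₂₀_mul, f.two_mul]
  b₀₂_mul _ _ _ _ := by simp [β.b₀₂_mul, f.two_mul]
  b₂₀_act _ _ _ := by simp [β.b₂₀_act, f.two_act]
  b₀₂_act _ _ _ _ _ := by simp [β.b₀₂_act, f.two_act]
  b₁₀_δ _ _ := by simp [β.b₁₀_δ, f.map_δ]
  b₀₁_δ _ _ _ := by simp [β.b₀₁_δ, f.map_δ]
  b₁₁_comp_right _ _ _ := by simp [β.b₁₁_comp_right, f.two_mul, f.two_act]
  b₁₁_comp_left _ _ _ := by simp [β.b₁₁_comp_left, f.two_mul, f.two_act]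
  δ_b₁₁ _ _ := by simp [← f.map_δ, β.δ_b₁₁]
  b₁₁_δ_right _ _ := by simp [β.b₁₁_δ_right, f.two_mul, f.two_act, f.two_inv]
  b₁₁_δ_left _ _ := by simp [β.b₁₁_δ_left, f.two_mul, f.two_act, f.two_inv]

/-- Composing a bimorphism with morphisms into its two arguments. -/
def precomp {A' B' : CrossedModule.{u}} (f : Hom A' A) (g : Hom B' B) : Bimorphism A' B' D where
  b₀₀ x y := β.b₀₀ (f.fn.obj x) (g.fn.obj y)
  b₁₀ a y := β.b₁₀ (f.fn.map a) (g.fn.obj y)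
  b₀₁ x _ _ b := β.b₀₁ (f.fn.obj x) (g.fn.map b)
  b₂₀ c y := β.b₂₀ (f.two c) (g.fn.obj y)
  b₀₂ x _ d := β.b₀₂ (f.fn.obj x) (g.two d)
  b₁₁ a b := β.b₁₁ (f.fn.map a) (g.fn.map b)
  b₁₀_comp _ _ _ := by simp [β.b₁₀_comp]
  b₀₁_comp _ _ _ _ _ _ := by simp [β.b₀₁_comp]
  b₂₀_mul _ _ _ := by simp [β.b₂₀_mul, f.two_mul]
  b₀₂_mul _ _ _ _ := by simp [β.b₀₂_mul, g.two_mul]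
  b₂₀_act _ _ _ := by simp [β.b₂₀_act, f.two_act]
  b₀₂_act _ _ _ _ _ := by simp [β.b₀₂_act, g.two_act]
  b₁₀_δ _ _ := by simp [β.b₁₀_δ, f.map_δ]
  b₀₁_δ _ _ _ := by simp [β.b₀₁_δ, g.map_δ]
  b₁₁_comp_right _ _ _ := by simp [β.b₁₁_comp_right]
  b₁₁_comp_left _ _ _ := by simp [β.b₁₁_comp_left]
  δ_b₁₁ _ _ := by simp [β.δ_b₁₁]
  b₁₁_δ_right _ _ := by simp [β.b₁₁_δ_right, g.map_δ]
  b₁₁_δ_left _ _ := by simp [β.b₁₁_δ_left, f.map_δ]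

/-- The morphism `B → D` obtained by fixing an object `x` in the first variable. -/
def right (x : A.Obj) : Hom B D where
  fn :=
    { obj := fun y => β.b₀₀ x y
      map := fun b => β.b₀₁ x b
      map_id := fun y => β.b₀₁_id x y
      map_comp := fun b b' => β.b₀₁_comp x b b' }
  two d := β.b₀₂ x d
  two_mul d d' := β.b₀₂_mul x d d'
  map_δ d := β.b₀₁_δ x d
  two_act d b := β.b₀₂_act x d b

/-- The homotopy `(y ↦ b₁₀ (a, y), b ↦ b₁₁ (a, b))` obtained by fixing an arrow `a` in the first
variable. -/
def rightHomotopy {x x' : A.Obj} (a : x ⟶ x') : Homotopy (β.right x) (β.right x') where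
  s₀ y := β.b₁₀ a y
  s₁ b := β.b₁₁ a b
  deriv b b' := β.b₁₁_comp_right a b b'
  source_map b := by
    have h : β.b₀₁ x b = β.b₁₀ a _ ≫ β.b₀₁ x' b ≫ D.δ (β.b₁₁ a b) ≫ inv (β.b₁₀ a _) := by
      simp [β.δ_b₁₁]
    exact h
  source_two d := by
    have h : β.b₀₂ x d = D.act (β.b₀₂ x' d * β.b₁₁ a (B.δ d)) (inv (β.b₁₀ a _)) := by
      simp [β.b₁₁_δ_right, D.act_act_inv]
    exact h

/-- A bimorphism `A, B → D` as a morphism `A → CMOD(B, D)`. -/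
def curry : Hom A (CMOD B D) where
  fn :=
    { obj := fun x => β.right x
      map := fun a => β.rightHomotopy a
      map_id := fun x => by
        apply Homotopy.ext
        · funext y
          exact β.b₁₀_id x y
        · funext y y' b
          change β.b₁₁ (𝟙 x) b = 1
          have h := β.b₁₁_comp_left (𝟙 x) (𝟙 x) b
          rw [Category.comp_id, b₁₀_id, D.act_id] at h
          exact (mul_eq_left (a := β.b₁₁ (𝟙 x) b)).1 h.symm
      map_comp := fun a a' => by
        apply Homotopy.ext
        · funext y
          exact β.b₁₀_comp a a' y
        · funext y y' b
          exact β.b₁₁_comp_left a a' b }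
  two c := fun y => β.b₂₀ c y
  two_mul c c' := by
    funext y
    exact β.b₂₀_mul c c' y
  map_δ c := by
    apply Homotopy.ext
    · funext y
      exact β.b₁₀_δ c y
    · funext y y' b
      exact β.b₁₁_δ_left c b
  two_act c a := by
    funext y
    exact β.b₂₀_act c a y

/-- A morphism `A → CMOD(B, D)` as a bimorphism `A, B → D`. -/
def uncurry (F : Hom A (CMOD B D)) : Bimorphism A B D where
  b₀₀ x y := (F.fn.obj x).fn.obj y
  b₁₀ a y := (F.fn.map a).s₀ y
  b₀₁ x _ _ b := (F.fn.obj x).fn.map b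
  b₂₀ c y := F.two c y
  b₀₂ x _ d := (F.fn.obj x).two d
  b₁₁ a b := (F.fn.map a).s₁ b
  b₁₀_comp a a' y := by rw [F.fn.map_comp]; rfl
  b₀₁_comp x _ _ _ b b' := (F.fn.obj x).fn.map_comp b b'
  b₂₀_mul c c' y := by rw [F.two_mul]; rfl
  b₀₂_mul x _ d d' := (F.fn.obj x).two_mul d d'
  b₂₀_act c a y := by rw [F.two_act]; rfl
  b₀₂_act x _ _ d b := (F.fn.obj x).two_act d b
  b₁₀_δ c y := by rw [F.map_δ]; rfl
  b₀₁_δ x _ d := (F.fn.obj x).map_δ d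
  b₁₁_comp_right a b b' := (F.fn.map a).deriv b b'
  b₁₁_comp_left a a' b := by rw [F.fn.map_comp]; rfl
  δ_b₁₁ a b := by rw [(F.fn.map a).source_map b]; simp
  b₁₁_δ_right a d := by rw [(F.fn.map a).source_two d, D.act_inv_act]; simp
  b₁₁_δ_left c b := by rw [F.map_δ]; rfl

theorem nest_aux {C E : CrossedModule.{u}} (β : Bimorphism A E D) (ν : Bimorphism B C E)
    {x x' : A.Obj} {y y' : B.Obj} {z z' : C.Obj} (a : x ⟶ x') (b : y ⟶ y') (c : z ⟶ z') :
    (D.act (β.b₁₁ a (ν.b₁₀ b z)) (β.b₀₁ x' (ν.b₀₁ y' c)))⁻¹ * β.b₁₁ a (ν.b₁₀ b z')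
      = ((β.b₁₁ a (ν.b₀₁ y' c) * D.act (β.b₀₂ x (ν.b₁₁ b c)) (β.b₁₀ a (ν.b₀₀ y' z')))
          * D.act (D.act (β.b₁₁ a (ν.b₀₁ y c))⁻¹ (inv (β.b₁₀ a (ν.b₀₀ y z'))))
            (β.b₀₁ x (ν.b₁₀ b z') ≫ β.b₁₀ a (ν.b₀₀ y' z')))
        * D.act (D.act (β.b₀₂ x' (ν.b₁₁ b c))⁻¹ (inv (β.b₀₁ x' (ν.b₁₀ b z'))))
          (inv (β.b₁₀ a (ν.b₀₀ y z')) ≫ β.b₀₁ x (ν.b₁₀ b z') ≫ β.b₁₀ a (ν.b₀₀ y' z')) := by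
  have e1 : ν.b₀₁ y c ≫ ν.b₁₀ b z' = ν.b₁₀ b z ≫ ν.b₀₁ y' c ≫ E.δ (ν.b₁₁ b c) := by
    simp [ν.δ_b₁₁]
  have e2 := congrArg (fun t => β.b₁₁ a t) e1
  simp only [β.b₁₁_comp_right, β.b₁₁_δ_right, β.b₀₁_comp, β.b₀₁_δ, D.act_comp, D.act_δ] at e2
  have e3 : inv (β.b₁₀ a (ν.b₀₀ y z')) ≫ β.b₀₁ x (ν.b₁₀ b z') ≫ β.b₁₀ a (ν.b₀₀ y' z')
      = β.b₀₁ x' (ν.b₁₀ b z') ≫ D.δ (β.b₁₁ a (ν.b₁₀ b z')) := by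
    simp [β.δ_b₁₁]
  rw [← D.act_comp _ (inv (β.b₁₀ a (ν.b₀₀ y z'))), e3, D.act_comp, D.act_comp, D.act_δ, D.act_δ,
    D.act_inv_act, D.inv_act]
  have e4 := eq_mul_inv_of_mul_eq e2
  rw [e4]
  group

/-- For bimorphisms `β : A, E → D` and `ν : B, C → E`, the assignment
`(a, b) ↦ (c ↦ β (a, ν (b, c)))`, as a bimorphism `A, B → CMOD(C, D)`. -/
def nest {C E : CrossedModule.{u}} (β : Bimorphism A E D) (ν : Bimorphism B C E) :
    Bimorphism A B (CMOD C D) where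
  b₀₀ x y := (ν.right y).comp (β.right x)
  b₁₀ a y :=
    { s₀ := fun z => β.b₁₀ a (ν.b₀₀ y z)
      s₁ := fun c => β.b₁₁ a (ν.b₀₁ y c)
      deriv := fun c c' => by
        rw [ν.b₀₁_comp]
        exact β.b₁₁_comp_right _ _ _
      source_map := fun c => (β.rightHomotopy a).source_map (ν.b₀₁ y c)
      source_two := fun d => by
        rw [ν.b₀₁_δ]
        exact (β.rightHomotopy a).source_two (ν.b₀₂ y d) }
  b₀₁ x _ _ b :=
    { s₀ := fun z => β.b₀₁ x (ν.b₁₀ b z)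
      s₁ := fun c => β.b₀₂ x (ν.b₁₁ b c)
      deriv := fun c c' => by
        refine (congrArg (fun t => β.b₀₂ x t) (ν.b₁₁_comp_right b c c')).trans ?_
        rw [β.b₀₂_mul, β.b₀₂_act]
        rfl
      source_map := fun {z z'} c => by
        have h := congrArg (fun t => β.b₀₁ x t) ((ν.rightHomotopy b).source_map c)
        refine h.trans ?_
        rw [β.b₀₁_comp, β.b₀₁_comp, β.b₀₁_comp, β.b₀₁_δ, β.b₀₁_inv]
        rfl
      source_two := fun {z} d => by
        have h := congrArg (fun t => β.b₀₂ x t) ((ν.rightHomotopy b).source_two d)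
        refine h.trans ?_
        rw [β.b₀₂_act, β.b₀₂_mul, β.b₀₁_inv]
        rfl }
  b₂₀ c y := fun z => β.b₂₀ c (ν.b₀₀ y z)
  b₀₂ x _ d := fun z => β.b₀₂ x (ν.b₂₀ d z)
  b₁₁ a b := fun z => β.b₁₁ a (ν.b₁₀ b z)
  b₁₀_comp a a' y := by
    apply Homotopy.ext
    · funext z
      exact β.b₁₀_comp _ _ _
    · funext z z' c
      exact β.b₁₁_comp_left _ _ _
  b₀₁_comp x _ _ _ b b' := by
    apply Homotopy.ext
    · funext z
      exact (congrArg (fun t => β.b₀₁ x t) (ν.b₁₀_comp b b' z)).trans (β.b₀₁_comp _ _ _)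
    · funext z z' c
      refine (congrArg (fun t => β.b₀₂ x t) (ν.b₁₁_comp_left b b' c)).trans ?_
      rw [β.b₀₂_mul, β.b₀₂_act]; rfl
  b₂₀_mul c c' y := by
    funext z
    exact β.b₂₀_mul _ _ _
  b₀₂_mul x _ d d' := by
    funext z
    exact (congrArg (fun t => β.b₀₂ x t) (ν.b₂₀_mul d d' z)).trans (β.b₀₂_mul _ _ _)
  b₂₀_act c a y := by
    funext z
    exact β.b₂₀_act _ _ _
  b₀₂_act x _ _ d b := by
    funext z
    exact (congrArg (fun t => β.b₀₂ x t) (ν.b₂₀_act d b z)).trans (β.b₀₂_act _ _ _)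
  b₁₀_δ c y := by
    apply Homotopy.ext
    · funext z
      exact β.b₁₀_δ _ _
    · funext z z' t
      exact β.b₁₁_δ_left _ _
  b₀₁_δ x _ d := by
    apply Homotopy.ext
    · funext z
      exact (congrArg (fun t => β.b₀₁ x t) (ν.b₁₀_δ d z)).trans (β.b₀₁_δ _ _)
    · funext z z' t
      refine (congrArg (fun t => β.b₀₂ x t) (ν.b₁₁_δ_left d t)).trans ?_
      rw [β.b₀₂_mul, β.b₀₂_inv, β.b₀₂_act]; rfl
  b₁₁_comp_right a b b' := by
    funext z
    exact (congrArg (fun t => β.b₁₁ a t) (ν.b₁₀_comp b b' z)).trans (β.b₁₁_comp_right _ _ _)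
  b₁₁_comp_left a a' b := by
    funext z
    exact β.b₁₁_comp_left _ _ _
  δ_b₁₁ {x x' y y'} a b := by
    refine eq_of_groupoid_inv ?_
    apply Homotopy.ext
    · funext z
      exact β.δ_b₁₁ a (ν.b₁₀ b z)
    · funext z z' c
      exact β.nest_aux ν a b c
  b₁₁_δ_right a d := by
    funext z
    exact (congrArg (fun t => β.b₁₁ a t) (ν.b₁₀_δ d z)).trans (β.b₁₁_δ_right _ _)
  b₁₁_δ_left c b := by
    funext z
    exact β.b₁₁_δ_left _ _

end Bimorphism

/-! ### The tensor product -/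

/-- Formal arrows of the tensor product. -/
inductive Term₁ (A B : CrossedModule.{u}) : A.Obj × B.Obj → A.Obj × B.Obj → Type u
  | left {x x' : A.Obj} (a : x ⟶ x') (y : B.Obj) : Term₁ A B (x, y) (x', y)
  | right (x : A.Obj) {y y' : B.Obj} (b : y ⟶ y') : Term₁ A B (x, y) (x, y')
  | one (p : A.Obj × B.Obj) : Term₁ A B p p
  | comp {p q r : A.Obj × B.Obj} (s : Term₁ A B p q) (t : Term₁ A B q r) : Term₁ A B p r
  | inv {p q : A.Obj × B.Obj} (s : Term₁ A B p q) : Term₁ A B q p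

/-- Formal elements of the vertex groups of the tensor product. -/
inductive Term₂ (A B : CrossedModule.{u}) : A.Obj × B.Obj → Type u
  | left {x : A.Obj} (c : A.Two x) (y : B.Obj) : Term₂ A B (x, y)
  | right (x : A.Obj) {y : B.Obj} (d : B.Two y) : Term₂ A B (x, y)
  | cross {x x' : A.Obj} {y y' : B.Obj} (a : x ⟶ x') (b : y ⟶ y') : Term₂ A B (x', y')
  | one (p : A.Obj × B.Obj) : Term₂ A B p
  | mul {p : A.Obj × B.Obj} (c d : Term₂ A B p) : Term₂ A B p
  | inv {p : A.Obj × B.Obj} (c : Term₂ A B p) : Term₂ A B p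
  | act {p q : A.Obj × B.Obj} (c : Term₂ A B p) (s : Term₁ A B p q) : Term₂ A B q

section Terms

variable {A B D : CrossedModule.{u}}

/-- The formal boundary. -/
def Term₂.bd : ∀ {p : A.Obj × B.Obj}, Term₂ A B p → Term₁ A B p p
  | _, .left c y => .left (A.δ c) y
  | _, .right x d => .right x (B.δ d)
  | _, .cross (x := x) (x' := x') (y := y) (y' := y') a b =>
      .comp (.inv (.right x' b)) (.comp (.inv (.left a y)) (.comp (.right x b) (.left a y')))
  | _, .one p => .one p
  | _, .mul c d => .comp c.bd d.bd
  | _, .inv c => .inv c.bd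
  | _, .act c s => .comp (.inv s) (.comp c.bd s)

/-- The value of a formal arrow under a bimorphism. -/
def Term₁.eval (β : Bimorphism A B D) :
    ∀ {p q : A.Obj × B.Obj}, Term₁ A B p q → (β.b₀₀ p.1 p.2 ⟶ β.b₀₀ q.1 q.2)
  | _, _, .left a y => β.b₁₀ a y
  | _, _, .right x b => β.b₀₁ x b
  | _, _, .one _ => 𝟙 _
  | _, _, .comp s t => s.eval β ≫ t.eval β
  | _, _, .inv s => CategoryTheory.inv (s.eval β)

/-- The value of a formal vertex group element under a bimorphism. -/
def Term₂.eval (β : Bimorphism A B D) :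
    ∀ {p : A.Obj × B.Obj}, Term₂ A B p → D.Two (β.b₀₀ p.1 p.2)
  | _, .left c y => β.b₂₀ c y
  | _, .right x d => β.b₀₂ x d
  | _, .cross a b => β.b₁₁ a b
  | _, .one _ => 1
  | _, .mul c d => c.eval β * d.eval β
  | _, .inv c => (c.eval β)⁻¹
  | _, .act c s => D.act (c.eval β) (s.eval β)

theorem Term₂.eval_bd (β : Bimorphism A B D) {p : A.Obj × B.Obj} (c : Term₂ A B p) :
    c.bd.eval β = D.δ (c.eval β) := by
  induction c with
  | left c y => exact β.b₁₀_δ c y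
  | right x d => exact β.b₀₁_δ x d
  | cross a b => exact (β.δ_b₁₁ a b).symm
  | one p => exact (D.δ_one _).symm
  | mul c d hc hd =>
    simp only [Term₂.bd, Term₁.eval, Term₂.eval, hc, hd, D.δ_mul]
  | inv c hc => simp only [Term₂.bd, Term₁.eval, Term₂.eval, hc, D.δ_inv]
  | act c s hc => simp only [Term₂.bd, Term₁.eval, Term₂.eval, hc, D.δ_act]

end Terms

/-- Two formal arrows are identified when they have the same value under every bimorphism, that
is, when the equation between them follows from the laws of crossed modules and bimorphisms. -/
abbrev rel₁ (A B : CrossedModule.{u}) (p q : A.Obj × B.Obj) : Setoid (Term₁ A B p q) where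
  r s t := ∀ (D : CrossedModule.{u}) (β : Bimorphism A B D), s.eval β = t.eval β
  iseqv := ⟨fun _ _ _ => rfl, fun h D β => (h D β).symm, fun h k D β => (h D β).trans (k D β)⟩

/-- Two formal vertex group elements are identified when they have the same value under every
bimorphism. -/
abbrev rel₂ (A B : CrossedModule.{u}) (p : A.Obj × B.Obj) : Setoid (Term₂ A B p) where
  r s t := ∀ (D : CrossedModule.{u}) (β : Bimorphism A B D), s.eval β = t.eval β
  iseqv := ⟨fun _ _ _ => rfl, fun h D β => (h D β).symm, fun h k D β => (h D β).trans (k D β)⟩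

theorem rel₁_eval {A B D : CrossedModule.{u}} {p q : A.Obj × B.Obj} {s t : Term₁ A B p q}
    (h : (rel₁ A B p q).r s t) (β : Bimorphism A B D) : s.eval β = t.eval β := h D β

theorem rel₂_eval {A B D : CrossedModule.{u}} {p : A.Obj × B.Obj} {s t : Term₂ A B p}
    (h : (rel₂ A B p).r s t) (β : Bimorphism A B D) : s.eval β = t.eval β := h D β

/-- The groupoid of the tensor product. -/
abbrev tensorGroupoid (A B : CrossedModule.{u}) : Groupoid.{u} (A.Obj × B.Obj) where
  Hom p q := Quotient (rel₁ A B p q)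
  id p := Quotient.mk _ (.one p)
  comp s t := Quotient.map₂ Term₁.comp (fun _ _ h _ _ k D β => by
    simp only [Term₁.eval, rel₁_eval h β, rel₁_eval k β]) s t
  inv s := Quotient.map Term₁.inv (fun s t h D β => by
    have h' : s.eval β = t.eval β := h D β
    simp only [Term₁.eval, h']) s
  id_comp := by
    rintro p q ⟨s⟩
    exact Quotient.sound fun D β => Category.id_comp _
  comp_id := by
    rintro p q ⟨s⟩
    exact Quotient.sound fun D β => Category.comp_id _
  assoc := by
    rintro p q r w ⟨s⟩ ⟨t⟩ ⟨v⟩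
    exact Quotient.sound fun D β => Category.assoc _ _ _
  inv_comp := by
    rintro p q ⟨s⟩
    exact Quotient.sound fun D β => IsIso.inv_hom_id _
  comp_inv := by
    rintro p q ⟨s⟩
    exact Quotient.sound fun D β => IsIso.hom_inv_id _

/-- The vertex groups of the tensor product. -/
abbrev tensorGroup (A B : CrossedModule.{u}) (p : A.Obj × B.Obj) : Group (Quotient (rel₂ A B p)) where
  mul c d := Quotient.map₂ Term₂.mul (fun _ _ h _ _ k D β =>
    congrArg₂ (fun x y => x * y) (rel₂_eval h β) (rel₂_eval k β)) c d
  one := Quotient.mk _ (.one p)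
  inv c := Quotient.map Term₂.inv (fun _ _ h D β => congrArg (fun x => x⁻¹) (rel₂_eval h β)) c
  mul_assoc := by
    rintro ⟨c⟩ ⟨d⟩ ⟨e⟩
    exact Quotient.sound fun D β => mul_assoc _ _ _
  one_mul := by
    rintro ⟨c⟩
    exact Quotient.sound fun D β => one_mul _
  mul_one := by
    rintro ⟨c⟩
    exact Quotient.sound fun D β => mul_one _
  inv_mul_cancel := by
    rintro ⟨c⟩
    exact Quotient.sound fun D β => inv_mul_cancel _

/-- The tensor product `A ⊗ B`: the crossed module on the object set `A₀ × B₀` generated by the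
symbols `a ⊗ y`, `x ⊗ b`, `c ⊗ y`, `x ⊗ d`, `a ⊗ b`, subject to the relations which make
`(A, B) → A ⊗ B` a bimorphism.  It is the target of the universal bimorphism out of `A, B`, see
`tensorUniv`, `tensorLift` and `tensorEquiv`. -/
def tensor (A B : CrossedModule.{u}) : CrossedModule.{u} where
  Obj := A.Obj × B.Obj
  grpd := tensorGroupoid A B
  Two p := Quotient (rel₂ A B p)
  grp p := tensorGroup A B p
  δ c := Quotient.map (sb := rel₁ A B _ _) Term₂.bd (fun s t h D β => by
    rw [Term₂.eval_bd, Term₂.eval_bd, h D β]) c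
  δ_mul := by
    rintro p ⟨c⟩ ⟨d⟩
    exact Quotient.sound fun D β => rfl
  act c s := Quotient.map₂ Term₂.act (fun _ _ h _ _ k D β => by
    simp only [Term₂.eval, rel₂_eval h β, rel₁_eval k β]) c s
  mul_act := by
    rintro p q ⟨c⟩ ⟨d⟩ ⟨s⟩
    exact Quotient.sound fun D β => D.mul_act _ _ _
  act_comp := by
    rintro p q r ⟨c⟩ ⟨s⟩ ⟨t⟩
    exact Quotient.sound fun D β => D.act_comp _ _ _
  act_id := by
    rintro p ⟨c⟩
    exact Quotient.sound fun D β => D.act_id _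
  δ_act := by
    rintro p q ⟨c⟩ ⟨s⟩
    refine @conj_of_groupoid_inv _ (tensorGroupoid A B) _ _ _ _ _ ?_
    exact Quotient.sound fun D β => rfl
  act_δ := by
    rintro p ⟨c⟩ ⟨d⟩
    refine Quotient.sound fun D β => ?_
    change D.act (c.eval β) (d.bd.eval β) = (d.eval β)⁻¹ * c.eval β * d.eval β
    rw [Term₂.eval_bd, D.act_δ]

/-- The universal bimorphism `A, B → A ⊗ B`. -/
def tensorUniv (A B : CrossedModule.{u}) : Bimorphism A B (tensor A B) where
  b₀₀ x y := (x, y)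
  b₁₀ a y := Quotient.mk _ (.left a y)
  b₀₁ x _ _ b := Quotient.mk _ (.right x b)
  b₂₀ c y := Quotient.mk _ (.left c y)
  b₀₂ x _ d := Quotient.mk _ (.right x d)
  b₁₁ a b := Quotient.mk _ (.cross a b)
  b₁₀_comp a a' y := Quotient.sound fun D β => β.b₁₀_comp a a' y
  b₀₁_comp x _ _ _ b b' := Quotient.sound fun D β => β.b₀₁_comp x b b'
  b₂₀_mul c c' y := Quotient.sound fun D β => β.b₂₀_mul c c' y
  b₀₂_mul x _ d d' := Quotient.sound fun D β => β.b₀₂_mul x d d'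
  b₂₀_act c a y := Quotient.sound fun D β => β.b₂₀_act c a y
  b₀₂_act x _ _ d b := Quotient.sound fun D β => β.b₀₂_act x d b
  b₁₀_δ c y := rfl
  b₀₁_δ x _ d := rfl
  b₁₁_comp_right a b b' := Quotient.sound fun D β => β.b₁₁_comp_right a b b'
  b₁₁_comp_left a a' b := Quotient.sound fun D β => β.b₁₁_comp_left a a' b
  δ_b₁₁ a b := by
    refine eq_of_groupoid_inv ?_
    rfl
  b₁₁_δ_right a d := Quotient.sound fun D β => β.b₁₁_δ_right a d
  b₁₁_δ_left c b := Quotient.sound fun D β => β.b₁₁_δ_left c b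

/-- The morphism `A ⊗ B → D` corresponding to a bimorphism `A, B → D`. -/
def tensorLift {A B D : CrossedModule.{u}} (β : Bimorphism A B D) : Hom (tensor A B) D where
  fn :=
    { obj := fun p => β.b₀₀ p.1 p.2
      map := fun s => Quotient.lift (fun t => t.eval β) (fun _ _ h => rel₁_eval h β) s
      map_id := fun _ => rfl
      map_comp := by
        rintro p q r ⟨s⟩ ⟨t⟩
        rfl }
  two c := Quotient.lift (fun t => t.eval β) (fun _ _ h => rel₂_eval h β) c
  two_mul := by
    rintro p ⟨c⟩ ⟨d⟩
    rfl
  map_δ := by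
    rintro p ⟨c⟩
    exact Term₂.eval_bd β c
  two_act := by
    rintro p q ⟨c⟩ ⟨s⟩
    rfl

/-- The bimorphism `A, B → D` corresponding to a morphism `A ⊗ B → D`. -/
def tensorBimorphism {A B D : CrossedModule.{u}} (f : Hom (tensor A B) D) : Bimorphism A B D :=
  (tensorUniv A B).postcomp f

theorem tensorBimorphism_tensorLift {A B D : CrossedModule.{u}} (β : Bimorphism A B D) :
    tensorBimorphism (tensorLift β) = β := rfl

theorem hom_map_inv {A B : CrossedModule.{u}} (f : Hom A B) {x y : A.Obj} (a : x ⟶ y) :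
    f.fn.map (Groupoid.inv a) = inv (f.fn.map a) := by
  rw [Groupoid.inv_eq_inv, f.fn.map_inv]

theorem tensorLift_tensorBimorphism {A B D : CrossedModule.{u}} (f : Hom (tensor A B) D) :
    tensorLift (tensorBimorphism f) = f := by
  have h₁ : ∀ {p q : A.Obj × B.Obj} (t : Term₁ A B p q),
      t.eval (tensorBimorphism f) = f.fn.map (X := p) (Y := q) (Quotient.mk (rel₁ A B p q) t) := by
    intro p q t
    induction t with
    | left a y => rfl
    | right x b => rfl
    | one p => exact (f.fn.map_id p).symm
    | comp s t hs ht =>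
      refine (congrArg₂ (fun x y => x ≫ y) hs ht).trans ?_
      exact (f.fn.map_comp _ _).symm
    | inv s hs =>
      refine (congrArg (fun x => CategoryTheory.inv x) hs).trans ?_
      exact (hom_map_inv f _).symm
  have h₂ : ∀ {p : A.Obj × B.Obj} (t : Term₂ A B p),
      t.eval (tensorBimorphism f) = f.two (x := p) (Quotient.mk (rel₂ A B p) t) := by
    intro p t
    induction t with
    | left c y => rfl
    | right x d => rfl
    | cross a b => rfl
    | one p => exact (f.two_one p).symm
    | mul c d hc hd =>
      refine (congrArg₂ (fun x y => x * y) hc hd).trans ?_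
      exact (f.two_mul _ _).symm
    | inv c hc =>
      refine (congrArg (fun x => x⁻¹) hc).trans ?_
      exact (f.two_inv _).symm
    | act c s hc =>
      refine (congrArg₂ (fun x y => D.act x y) hc (h₁ s)).trans ?_
      exact (f.two_act _ _).symm
  apply Hom.ext
  · exact CategoryTheory.Functor.hext (fun _ => rfl) fun p q s => heq_of_eq (by
      induction s using Quotient.ind
      exact h₁ _)
  · apply heq_of_eq
    funext p c
    induction c using Quotient.ind
    exact h₂ _

/-- Morphisms `A ⊗ B → D` correspond bijectively to bimorphisms `A, B → D`. -/
def tensorEquiv (A B D : CrossedModule.{u}) : Hom (tensor A B) D ≃ Bimorphism A B D where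
  toFun := tensorBimorphism
  invFun := tensorLift
  left_inv := tensorLift_tensorBimorphism
  right_inv := tensorBimorphism_tensorLift

/-- The bijection `θ : Cmod(A ⊗ B, D) ≃ Cmod(A, CMOD(B, D))`. -/
def theta (A B D : CrossedModule.{u}) : Hom (tensor A B) D ≃ Hom A (CMOD B D) :=
  (tensorEquiv A B D).trans
    { toFun := Bimorphism.curry
      invFun := Bimorphism.uncurry
      left_inv := fun _ => rfl
      right_inv := fun _ => rfl }

/-- The tensor product `f ⊗ g` of morphisms. -/
def tensorMap {A A' B B' : CrossedModule.{u}} (f : Hom A A') (g : Hom B B') :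
    Hom (tensor A B) (tensor A' B') :=
  tensorLift ((tensorUniv A' B').precomp f g)

/-- The associativity morphism `(A ⊗ B) ⊗ C → A ⊗ (B ⊗ C)`, `(a ⊗ b) ⊗ c ↦ a ⊗ (b ⊗ c)`. -/
def assoc (A B C : CrossedModule.{u}) :
    Hom (tensor (tensor A B) C) (tensor A (tensor B C)) :=
  (theta (tensor A B) C (tensor A (tensor B C))).symm
    (tensorLift ((tensorUniv A (tensor B C)).nest (tensorUniv B C)))

/-- The left unit morphism `* ⊗ C → C`, `* ⊗ c ↦ c`. -/
def lambda (C : CrossedModule.{u}) : Hom (tensor point C) C :=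
  tensorLift
    { b₀₀ := fun _ y => y
      b₁₀ := fun _ y => 𝟙 y
      b₀₁ := fun _ _ _ b => b
      b₂₀ := fun _ _ => 1
      b₀₂ := fun _ _ d => d
      b₁₁ := fun _ _ => 1
      b₁₀_comp := by simp
      b₀₁_comp := by simp
      b₂₀_mul := by simp
      b₀₂_mul := by simp
      b₂₀_act := by simp [C.act_id]
      b₀₂_act := by simp
      b₁₀_δ := by simp [C.δ_one]
      b₀₁_δ := by simp
      b₁₁_comp_right := by simp [C.one_act]
      b₁₁_comp_left := by simp [C.one_act]
      δ_b₁₁ := by simp [C.δ_one]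
      b₁₁_δ_right := by simp [C.act_id]
      b₁₁_δ_left := by simp [C.one_act] }

/-- The right unit morphism `C ⊗ * → C`, `c ⊗ * ↦ c`. -/
def rho (C : CrossedModule.{u}) : Hom (tensor C point) C :=
  tensorLift
    { b₀₀ := fun x _ => x
      b₁₀ := fun a _ => a
      b₀₁ := fun x _ _ _ => 𝟙 x
      b₂₀ := fun c _ => c
      b₀₂ := fun _ _ _ => 1
      b₁₁ := fun _ _ => 1
      b₁₀_comp := by simp
      b₀₁_comp := by simp
      b₂₀_mul := by simp
      b₀₂_mul := by simp
      b₂₀_act := by simp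
      b₀₂_act := by simp [C.act_id]
      b₁₀_δ := by simp
      b₀₁_δ := by simp [C.δ_one]
      b₁₁_comp_right := by simp [C.one_act]
      b₁₁_comp_left := by simp [C.one_act]
      δ_b₁₁ := by simp [C.δ_one]
      b₁₁_δ_right := by simp [C.one_act]
      b₁₁_δ_left := by simp [C.act_id] }

/-- The evaluation morphism `ε : CMOD(A, B) ⊗ A → B`, with `θ ε` the identity. -/
def evaluation (A B : CrossedModule.{u}) : Hom (tensor (CMOD A B) A) B :=
  (theta (CMOD A B) A B).symm (Hom.id (CMOD A B))

/-- The composition morphism `γ : CMOD(B, C) ⊗ CMOD(A, B) → CMOD(A, C)`, corresponding under `θ`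
to `(CMOD(B, C) ⊗ CMOD(A, B)) ⊗ A → CMOD(B, C) ⊗ (CMOD(A, B) ⊗ A) → CMOD(B, C) ⊗ B → C`. -/
def composition (A B C : CrossedModule.{u}) :
    Hom (tensor (CMOD B C) (CMOD A B)) (CMOD A C) :=
  theta (tensor (CMOD B C) (CMOD A B)) A C
    (((assoc (CMOD B C) (CMOD A B) A).comp
      (tensorMap (Hom.id (CMOD B C)) (evaluation A B))).comp (evaluation B C))

/-- The multiplication `μ : END(C) ⊗ END(C) → END(C)`. -/
def endMul (C : CrossedModule.{u}) : Hom (tensor (END C) (END C)) (END C) :=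
  composition C C C

/-- The unit `η : * → END(C)`, corresponding under `θ` to `* ⊗ C → C`. -/
def endUnit (C : CrossedModule.{u}) : Hom point (END C) :=
  theta point C C (lambda C)

/-- `(M, μ, η)` is a monoid with respect to the tensor product. -/
structure IsTensorMonoid (M : CrossedModule.{u}) (μ : Hom (tensor M M) M) (η : Hom point M) :
    Prop where
  associative : (tensorMap μ (Hom.id M)).comp μ
    = ((assoc M M M).comp (tensorMap (Hom.id M) μ)).comp μ
  left_unital : (tensorMap η (Hom.id M)).comp μ = lambda M
  right_unital : (tensorMap (Hom.id M) η).comp μ = rho M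

/-! ### Braided semiregular crossed modules -/

/-- The structure of a braided semiregular crossed module on `A`: a monoid bimorphism
`A, A → A`.  Here `b₀₀ x y` is the product `xy`, `b₀ⱼ x` and `bᵢ₀ · y` are the left action
`x.c` and the right action `c.y`, and `b₁₁ a b` is the braiding `{a, b}`.  The two sides of a law
stated with `HEq` lie over objects which are equal by the monoid laws. -/
structure SemiregularBraiding (A : CrossedModule.{u}) extends Bimorphism A A A where
  e : A.Obj
  obj_assoc : ∀ x y z : A.Obj, b₀₀ (b₀₀ x y) z = b₀₀ x (b₀₀ y z)
  e_obj : ∀ x : A.Obj, b₀₀ e x = x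
  obj_e : ∀ x : A.Obj, b₀₀ x e = x
  e_arrow : ∀ {x x' : A.Obj} (a : x ⟶ x'), HEq (b₀₁ e a) a
  arrow_e : ∀ {x x' : A.Obj} (a : x ⟶ x'), HEq (b₁₀ a e) a
  mul_arrow : ∀ (x y : A.Obj) {z z' : A.Obj} (a : z ⟶ z'),
    HEq (b₀₁ (b₀₀ x y) a) (b₀₁ x (b₀₁ y a))
  arrow_mul : ∀ {z z' : A.Obj} (a : z ⟶ z') (x y : A.Obj),
    HEq (b₁₀ a (b₀₀ x y)) (b₁₀ (b₁₀ a x) y)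
  arrow_comm : ∀ (x : A.Obj) {z z' : A.Obj} (a : z ⟶ z') (y : A.Obj),
    HEq (b₀₁ x (b₁₀ a y)) (b₁₀ (b₀₁ x a) y)
  e_two : ∀ {x : A.Obj} (c : A.Two x), HEq (b₀₂ e c) c
  two_e : ∀ {x : A.Obj} (c : A.Two x), HEq (b₂₀ c e) c
  mul_two : ∀ (x y : A.Obj) {z : A.Obj} (c : A.Two z),
    HEq (b₀₂ (b₀₀ x y) c) (b₀₂ x (b₀₂ y c))
  two_mul : ∀ {z : A.Obj} (c : A.Two z) (x y : A.Obj),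
    HEq (b₂₀ c (b₀₀ x y)) (b₂₀ (b₂₀ c x) y)
  two_comm : ∀ (x : A.Obj) {z : A.Obj} (c : A.Two z) (y : A.Obj),
    HEq (b₀₂ x (b₂₀ c y)) (b₂₀ (b₀₂ x c) y)
  braid_zero_left : ∀ {y y' : A.Obj} (b : y ⟶ y'), HEq (b₁₁ (𝟙 e) b) (1 : A.Two y')
  braid_zero_right : ∀ {x x' : A.Obj} (a : x ⟶ x'), HEq (b₁₁ a (𝟙 e)) (1 : A.Two x')
  act_braid : ∀ (x : A.Obj) {y y' z z' : A.Obj} (a : y ⟶ y') (b : z ⟶ z'),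
    HEq (b₀₂ x (b₁₁ a b)) (b₁₁ (b₀₁ x a) b)
  braid_act : ∀ {y y' z z' : A.Obj} (a : y ⟶ y') (b : z ⟶ z') (x : A.Obj),
    HEq (b₂₀ (b₁₁ a b) x) (b₁₁ a (b₁₀ b x))
  braid_mid : ∀ {y y' z z' : A.Obj} (a : y ⟶ y') (x : A.Obj) (b : z ⟶ z'),
    HEq (b₁₁ (b₁₀ a x) b) (b₁₁ a (b₀₁ x b))

end CrossedModule

end

/-! Under the internal hom, `END C` is the crossed module of endomorphisms of `C`, and its
multiplication is composition. Evaluating a morphism, homotopy or section on the data of `C` is a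
bimorphism, and nesting evaluation in itself, `(a, b) ↦ (z ↦ a (b z))`, gives the bimorphism of
`endMul C`. On objects it composes endomorphisms, in mixed degrees it whiskers a homotopy or a
section by an endomorphism, and the braiding of homotopies `a` and `b` is the section `z ↦ a.s₁
(b.s₀ z)`. That this is a bimorphism is the content of `Bimorphism.nest`. Its hardest axiom, the
boundary of the braiding, comes from applying the derivation of `a` to the naturality squares of
`b`, which commute up to a boundary.

A morphism out of a tensor product is determined by its bimorphism, so a morphism out of a triple
tensor product is determined by a bimorphism of the first two variables with values in morphisms,
homotopies and sections on the third. In this form associativity of `endMul C` compares `(a b) c`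
with `a (b c)`, and substitution of functions is strictly associative:
`endBimorphism_postcomp_curry`. The left unit law is just as formal. The right unit law uses that
endomorphisms preserve identities and that a derivation is trivial on identities, `Homotopy.s₁_id`.

The semiregular laws are componentwise forms of the same facts. The three compatibilities of the
braiding with the monoid action express associativity with one object and two arrows among the three
arguments. -/

noncomputable section

namespace CrossedModule

/-- Evaluation of morphisms, homotopies and sections as a bimorphism `CMOD(A, B), A → B`. -/
def evalBimorphism (A B : CrossedModule.{u}) : Bimorphism (CMOD A B) A B :=
  Bimorphism.uncurry (Hom.id (CMOD A B))

/-- The multiplication of `END(C)` as a bimorphism. -/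
def endBimorphism (C : CrossedModule.{u}) : Bimorphism (END C) (END C) (END C) :=
  (evalBimorphism C C).nest (evalBimorphism C C)

/-- This makes `endMul C` computable. On generators, `assoc` sends `(a ⊗ b) ⊗ z` to `a ⊗ (b ⊗ z)`
and the two evaluations then apply `b` and `a` in turn. Lifts out of the quotients reduce on
generators, so no computation remains. -/
theorem tensorBimorphism_endMul (C : CrossedModule.{u}) :
    tensorBimorphism (endMul C) = endBimorphism C := rfl

/-! ### From morphisms out of tensor products to bimorphisms -/

theorem Bimorphism.curry_injective {A B D : CrossedModule.{u}} :
    Function.Injective (Bimorphism.curry : Bimorphism A B D → Hom A (CMOD B D)) :=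
  fun _ _ h => congrArg Bimorphism.uncurry h

theorem tensorBimorphism_tensorMap_comp {A B A' B' D : CrossedModule.{u}} (f : Hom A A')
    (g : Hom B B') (h : Hom (tensor A' B') D) :
    tensorBimorphism ((tensorMap f g).comp h) = (tensorBimorphism h).precomp f g := rfl

/-- Since `assoc` is defined through `theta` from a nested universal bimorphism, precomposing with
it just rebrackets: a bimorphism on `A` and `B ⊗ C` is read as one on `A` and `B` with the `C`
variable curried. -/
theorem tensorBimorphism_assoc_comp {A B C D : CrossedModule.{u}}
    (h : Hom (tensor A (tensor B C)) D) :
    tensorBimorphism (tensorBimorphism ((assoc A B C).comp h)).curry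
      = (tensorBimorphism h).nest (tensorUniv B C) := rfl

/-- Handles the factor `1 ⊗ μ` of the right-bracketed product: multiplying inside the second
argument becomes nesting. -/
theorem Bimorphism.precomp_nest_tensorUniv {A B C E D : CrossedModule.{u}}
    (β : Bimorphism A E D) (g : Hom (tensor B C) E) :
    (β.precomp (Hom.id A) g).nest (tensorUniv B C) = β.nest (tensorBimorphism g) := rfl

/-- The counterpart for the factor `μ ⊗ 1` of the left-bracketed product: multiplying inside the
first argument becomes postcomposition with the curried outer bimorphism. -/
theorem tensorBimorphism_curry_precomp {A B C E D : CrossedModule.{u}} (β : Bimorphism E C D)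
    (f : Hom (tensor A B) E) :
    tensorBimorphism (β.precomp f (Hom.id C)).curry
      = (tensorBimorphism f).postcomp β.curry := rfl

/-- The associative law itself, `c ↦ (a b) c` against `c ↦ a (b c)`. In every degree both sides
apply the same functions in the same order to the data of `C`, so the components agree
definitionally. -/
theorem endBimorphism_postcomp_curry (C : CrossedModule.{u}) :
    (endBimorphism C).postcomp (endBimorphism C).curry
      = (endBimorphism C).nest (endBimorphism C) := by
  apply Bimorphism.ext <;> rfl

theorem endMul_associative (C : CrossedModule.{u}) :
    (tensorMap (endMul C) (Hom.id (END C))).comp (endMul C)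
      = ((assoc (END C) (END C) (END C)).comp
          (tensorMap (Hom.id (END C)) (endMul C))).comp (endMul C) := by
  -- The outer tensor product is opened, the third variable is curried away, and the inner tensor
  -- product is opened. The `change` below also rebrackets the composite so that `assoc` comes
  -- first.
  apply (tensorEquiv _ _ _).injective
  apply Bimorphism.curry_injective
  apply (tensorEquiv _ _ _).injective
  change tensorBimorphism (tensorBimorphism _).curry
    = tensorBimorphism (tensorBimorphism ((assoc (END C) (END C) (END C)).comp
        ((tensorMap (Hom.id (END C)) (endMul C)).comp (endMul C)))).curry
  rw [tensorBimorphism_assoc_comp, tensorBimorphism_tensorMap_comp,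
    tensorBimorphism_tensorMap_comp, tensorBimorphism_endMul,
    Bimorphism.precomp_nest_tensorUniv, tensorBimorphism_curry_precomp,
    tensorBimorphism_endMul, endBimorphism_postcomp_curry]

/-! ### Unit laws -/

theorem endMul_left_unital (C : CrossedModule.{u}) :
    (tensorMap (endUnit C) (Hom.id (END C))).comp (endMul C) = lambda (END C) := by
  apply (tensorEquiv _ _ _).injective
  rfl

/-- Unlike on the left, the identity data of `endUnit C` are here fed into an arbitrary `x` or `a`,
and the result is trivial by a law and not by reduction. This affects the three components that
involve arrows or group elements of `*`. -/
theorem endMul_right_unital (C : CrossedModule.{u}) :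
    (tensorMap (Hom.id (END C)) (endUnit C)).comp (endMul C) = rho (END C) := by
  apply (tensorEquiv _ _ _).injective
  apply Bimorphism.ext
  · rfl
  · rfl
  · apply heq_of_eq
    funext x y y' b
    apply Homotopy.ext
    · funext z
      exact x.fn.map_id z
    · funext z z' a
      exact x.two_one _
  · rfl
  · apply heq_of_eq
    funext x y d z
    exact x.two_one _
  -- The braiding with an identity homotopy evaluates the derivation of `a` at `𝟙 z`.
  · apply heq_of_eq
    funext x x' y y' a b z
    exact Homotopy.s₁_id a z

/-! ### The braided semiregular structure -/

/-- The braided semiregular structure on `END(C)`. -/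
def endBraiding (C : CrossedModule.{u}) : SemiregularBraiding (END C) where
  toBimorphism := endBimorphism C
  e := Hom.id C
  -- Composition of endomorphisms is associative and unital up to definitional equality, so the two
  -- sides of each `HEq` law below have the same type.
  obj_assoc _ _ _ := rfl
  e_obj _ := rfl
  obj_e _ := rfl
  e_arrow _ := HEq.rfl
  arrow_e _ := HEq.rfl
  mul_arrow _ _ _ _ _ := HEq.rfl
  arrow_mul _ _ _ := HEq.rfl
  arrow_comm _ _ _ _ _ := HEq.rfl
  e_two _ := HEq.rfl
  two_e _ := HEq.rfl
  mul_two _ _ _ _ := HEq.rfl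
  two_mul _ _ _ := HEq.rfl
  two_comm _ _ _ _ := HEq.rfl
  braid_zero_left _ := HEq.rfl
  -- The one law that is not definitional: `a` is an arbitrary homotopy, and its derivation is
  -- trivial at identities. In `braid_zero_left` the derivation is that of the identity homotopy,
  -- which is constantly `1`.
  braid_zero_right a := heq_of_eq (funext fun z => Homotopy.s₁_id a z)
  act_braid _ _ _ _ _ _ _ := HEq.rfl
  braid_act _ _ _ := HEq.rfl
  braid_mid _ _ _ := HEq.rfl

theorem endUnit_obj (C : CrossedModule.{u}) (p : point.{u}.Obj) :
    (endUnit C).fn.obj p = Hom.id C := by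
  apply Hom.ext
  · rfl
  · rfl

end CrossedModule

end

theorem mainTheorem8 (C : CrossedModule.{u}) :
    CrossedModule.IsTensorMonoid (CrossedModule.END C) (CrossedModule.endMul C)
        (CrossedModule.endUnit C) ∧
      ∃ S : CrossedModule.SemiregularBraiding (CrossedModule.END C),
        S.toBimorphism = CrossedModule.tensorBimorphism (CrossedModule.endMul C) ∧
          S.e = (CrossedModule.endUnit C).fn.obj ⟨PUnit.unit⟩ :=
  ⟨⟨CrossedModule.endMul_associative C, CrossedModule.endMul_left_unital C,
    CrossedModule.endMul_right_unital C⟩, CrossedModule.endBraiding C, rfl,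
    (CrossedModule.endUnit_obj C _).symm⟩
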